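/- **Notation.** Let $s\ge 2$. For $1\le r\le s$ and $u\in\mathbb{Z}_{2^r}$ with binary expansion $u=\sum_{i=0}^{r-1}u_i2^i$, let $\phi_r(u)=(u_{r-1},\dots,u_{r-1})+(u_0,\dots,u_{r-2})Y_{r-1}\in\mathbb{Z}_2^{2^{r-1}}$ (Carlet's Gray map), where the columns of $Y_{r-1}$ are all the vectors of $\mathbb{Z}_2^{r-1}$, ordered as the binary expansions of $0,1,\dots,2^{r-1}-1$. Let $\Phi:\mathbb{Z}_2^{\alpha_1}\times\mathbb{Z}_4^{\alpha_2}\times\dots\times\mathbb{Z}_{2^s}^{\alpha_s}\to\mathbb{Z}_2^{\alpha_1+2\alpha_2+\dots+2^{s-1}\alpha_s}$ be the map that applies $\phi_r$ to every coordinate over $\mathbb{Z}_{2^r}$, for $r=1,\dots,s$. In matrices, $\mathbf{a}$ denotes a constant row vector with all entries $a$. For integers $t_1\ge1$, $t_2,\dots,t_{s-1}\ge0$, $t_s\ge1$ the matrix $A_2^{t_1,\dots,t_s}=(A_1\mid\dots\mid A_s)$, with $A_r$ over $\mathbb{Z}_{2^r}$, is built as follows. The matrix $A_2^{1,0,\dots,0,1}$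 has $A_1=\begin{pmatrix}1&1\\0&1\end{pmatrix}$ and $A_r=\begin{pmatrix}2^{r-1}\\1\end{pmatrix}$ for $2\le r\le s$. For $1\le i\le s$, let step $i$ be the operation that sends a matrix $(A_1\mid\dots\mid A_s)$ with $m$ rows to the matrix $(A_1'\mid\dots\mid A_s')$ with $m+1$ rows given by - $A_1'=\begin{pmatrix}A_1&A_1\\ \mathbf 0&\mathbf 1\end{pmatrix}$; - $A_r'=\begin{pmatrix}M_{r-1}&A_r&A_r&\cdots&A_r\\ \mathbf 1&\mathbf 0&\mathbf 1&\cdots&\mathbf{2^r-1}\end{pmatrix}$ for $2\le r\le s-i+1$, where the columns of $M_{r-1}$ are all the vectors with first entry $2^{r-1}$ and the other $m-1$ entries in $\{0,2,4,\dots,2(2^{r-1}-1)\}\subset\mathbb{Z}_{2^r}$, each taken once; - $A_r'=\begin{pmatrix}A_r&A_r&\cdots&A_r\\ 2^k\cdot\mathbf 0&2^k\cdot\mathbf 1&\cdots&2^k\cdot(\mathbf{2^{s-i+1}-1})\end{pmatrix}$ with $k=r-(s-i+1)$, for $s-i+1<r\le s$ and $r\geq 2$. Starting from $A_2^{1,0,\dots,0,1}$,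 apply step $1$ exactly $t_1-1$ times, then step $i$ exactly $t_i$ times for $i=2,\dots,s-1$ in this order, and finally step $s$ exactly $t_s-1$ times; the result is $A_2^{t_1,\dots,t_s}$. Let $\mathcal{H}_2^{t_1,\dots,t_s}$ be the additive group generated by its rows, and let $H_2^{t_1,\dots,t_s}=\Phi(\mathcal{H}_2^{t_1,\dots,t_s})$, a binary code. **Theorem.** Let $s\ge2$, $t_1\ge1$, $t_2,\dots,t_{s-1}\ge0$ and $t_s\ge1$ be integers. The code $H_2^{t_1,\dots,t_s}$ is linear over $\mathbb{Z}_2$ (that is, a linear subspace) if and only if $t_1=1$ and $t_2=\dots=t_{s-1}=0$. In other words, among the codes $H_2^{t_1,\dots,t_s}$, the codes $H_2^{1,0,\dots,0,t_s}$ with $t_s\ge1$ are linear, and all the others are nonlinear. -/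

import Mathlib

/-- A generator matrix `(A₁ | A₂ | ⋯)` with `rows` rows whose `r`-th block is a matrix over
`ℤ / p ^ r`. Block `r` is the list of its columns from left to right; a column is a function of the
row index, so its top entry is the value at `0`. Only the blocks `1 ≤ r ≤ s` are used for codes over
`ℤ_p, ℤ_{p²}, …, ℤ_{p^s}`. -/
structure GenMatrix (p : ℕ) where
  rows : ℕ
  block : (r : ℕ) → List (Fin rows → ZMod (p ^ r))

namespace GenMatrix

/-- For a list of columns `B` and `xs = [x₁, …, xₖ]` this is the block
`(B ⋯ B)` above the new bottom row `(𝐱₁ ⋯ 𝐱ₖ)`: one copy of `B` for each `xᵢ`, with the constant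
vector `𝐱ᵢ` written below it. -/
def appendRow {R : Type} {m : ℕ} (B : List (Fin m → R)) (xs : List R) :
    List (Fin (m + 1) → R) :=
  xs.flatMap fun x => B.map fun c => Fin.snoc (α := fun _ => R) c x

/-- All columns with `m ≥ 1` entries whose top entry is `x` and whose other entries run through
`l`, in lexicographic order: the columns `zᵀ` with `z ∈ {x} × l × ⋯ × l`. -/
def tuples {R : Type} (x : R) (l : List R) : (m : ℕ) → List (Fin m → R)
  | 0 => []
  | 1 => [fun _ => x]
  | m + 2 => (tuples x l (m + 1)).flatMap fun c => l.map fun y => Fin.snoc (α := fun _ => R) c y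

/-- The matrix `M_j` over `ℤ / p ^ (j + 1)` (here `r = j + 1 ≥ 2`) with `m` rows: its columns are the
`zᵀ` with `z ∈ {p ^ j} × {p * 0, p * 1, …, p * (p ^ j - 1)} ^ (m - 1)`. -/
def blockM (p r m : ℕ) : List (Fin m → ZMod (p ^ r)) :=
  tuples ((p : ZMod (p ^ r)) ^ (r - 1))
    ((List.range (p ^ (r - 1))).map fun a => (p : ZMod (p ^ r)) * (a : ZMod (p ^ r))) m

/-- The matrix `A_p^{1,0,…,0,1}`. Its block over `ℤ_p` has the columns `(1, a)ᵀ`, `0 ≤ a ≤ p - 1`,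
and for `2 ≤ r ≤ s` its block over `ℤ / p ^ r` has the columns `(p ^ (r - 1), a)ᵀ`,
`1 ≤ a ≤ p - 1`. -/
def base (p s : ℕ) : GenMatrix p where
  rows := 2
  block r :=
    if r = 1 then (List.range p).map fun a => ![1, (a : ZMod (p ^ r))]
    else if 2 ≤ r ∧ r ≤ s then
      (List.range' 1 (p - 1)).map fun a => ![(p : ZMod (p ^ r)) ^ (r - 1), (a : ZMod (p ^ r))]
    else []

/-- The construction that adds one row of order `p ^ (s - i + 1)` at the bottom, for `1 ≤ i ≤ s`.
It sends `(A₁ | ⋯ | A_s)` to the matrix with the blocks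
* `r = 1`: `A₁ ⋯ A₁` above `𝟎 ⋯ 𝐩-𝟏`;
* `2 ≤ r ≤ s - i + 1` (the matrix `P_{r-1}`): `M_{r-1} ⋯ M_{r-1}` above `𝟏 ⋯ 𝐩-𝟏`, followed by
  `A_r ⋯ A_r` above `𝟎 ⋯ 𝐩^𝐫-𝟏`;
* `s - i + 1 < r ≤ s` (the matrix `Q_k` with `k = r - (s - i + 1)`): `A_r ⋯ A_r` above
  `p ^ k * c` for `c = 0, …, p ^ (s - i + 1) - 1`. -/
def step (p s i : ℕ) (A : GenMatrix p) : GenMatrix p where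
  rows := A.rows + 1
  block r :=
    if r = 1 then
      appendRow (A.block r) ((List.range p).map fun a => (a : ZMod (p ^ r)))
    else if 2 ≤ r ∧ r ≤ s - i + 1 then
      appendRow (blockM p r A.rows) ((List.range' 1 (p - 1)).map fun a => (a : ZMod (p ^ r))) ++
        appendRow (A.block r) ((List.range (p ^ r)).map fun a => (a : ZMod (p ^ r)))
    else if s - i + 1 < r ∧ r ≤ s then
      appendRow (A.block r) ((List.range (p ^ (s - i + 1))).map fun c =>
        (p : ZMod (p ^ r)) ^ (r - (s - i + 1)) * (c : ZMod (p ^ r)))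
    else []

/-- The number of times that the construction `step p s i` is applied on the way from
`A_p^{1,0,…,0,1}` to `A_p^{t₁,…,t_s}`, where `t₁, t_s ≥ 1` and `s ≥ 2`. -/
def numSteps (s : ℕ) (t : ℕ → ℕ) (i : ℕ) : ℕ :=
  if i = 1 ∨ i = s then t i - 1 else t i

/-- The matrix `A_p^{t₁,…,t_s}` (with `t₁, t_s ≥ 1` and `s ≥ 2`): starting from `A_p^{1,0,…,0,1}`,
first add `t₁ - 1` rows with `i = 1`, then `t₂` rows with `i = 2`, and so on up to `t_{s-1}` rows
with `i = s - 1`, and finally `t_s - 1` rows with `i = s`. -/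
def ofType (p s : ℕ) (t : ℕ → ℕ) : GenMatrix p :=
  (List.range' 1 s).foldl (fun A i => (step p s i)^[numSteps s t i] A) (base p s)

/-- The group `ℤ_p^{α₁} × ℤ_{p²}^{α₂} × ⋯ × ℤ_{p^s}^{α_s}`, where `α_r` is the number of columns of
block `r` of `A`. -/
abbrev Word {p : ℕ} (A : GenMatrix p) (s : ℕ) : Type :=
  (r : Finset.Icc 1 s) → Fin (A.block r).length → ZMod (p ^ (r : ℕ))

/-- The `k`-th row of the blocks `1, …, s` of `A`. -/
def row {p : ℕ} (A : GenMatrix p) (s : ℕ) (k : Fin A.rows) : A.Word s :=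
  fun r j => (A.block r).get j k

/-- The additive code generated by the rows of `(A₁ | ⋯ | A_s)`. -/
def additiveCode {p : ℕ} (A : GenMatrix p) (s : ℕ) : AddSubgroup (A.Word s) :=
  AddSubgroup.closure (Set.range (A.row s))

end GenMatrix

/-- The `i`-th digit of the `p`-ary expansion of `n`, as an element of `ℤ_p`. -/
def digit (p n i : ℕ) : ZMod p := ((n / p ^ i % p : ℕ) : ZMod p)

/-- The Gray map `φ_r : ℤ / p ^ r → ℤ_p ^ (p ^ (r - 1))`,
`φ_r(u) = (u_{r-1}, …, u_{r-1}) + (u_0, …, u_{r-2}) Y_{r-1}`, where the `u_i` are the `p`-ary digits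
of `u` and column `y` of `Y_{r-1}` consists of the digits `y_0, …, y_{r-2}` of `y`. -/
def gray (p r : ℕ) (u : ZMod (p ^ r)) (y : Fin (p ^ (r - 1))) : ZMod p :=
  digit p u.val (r - 1) + ∑ i ∈ Finset.range (r - 1), digit p u.val i * digit p y i

/-- The set of coordinates of the Gray image of a word: for each block `r` and each of the `α_r`
coordinates of that block, `p ^ (r - 1)` coordinates over `ℤ_p`. -/
abbrev GenMatrix.Coord {p : ℕ} (A : GenMatrix p) (s : ℕ) : Type :=
  (r : Finset.Icc 1 s) × (Fin (A.block r).length × Fin (p ^ ((r : ℕ) - 1)))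

/-- The Gray map `Φ(y₁ | y₂ | ⋯ | y_s) = (y₁, Φ₂(y₂), …, Φ_s(y_s))`, that is, `φ_r` on every
coordinate of block `r`. -/
def GenMatrix.grayMap {p : ℕ} (A : GenMatrix p) (s : ℕ) (x : A.Word s) : A.Coord s → ZMod p :=
  fun q => gray p q.1 (x q.1 q.2.1) q.2.2

/-- The code `H_p^{t₁,…,t_s}` over `ℤ_p`: the Gray image of the additive code generated by
`A_p^{t₁,…,t_s}`. -/
def codeH (p s : ℕ) (t : ℕ → ℕ) : Set ((GenMatrix.ofType p s t).Coord s → ZMod p) :=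
  (GenMatrix.ofType p s t).grayMap s '' ((GenMatrix.ofType p s t).additiveCode s : Set _)

/-- A code over `ℤ_p` is linear if it is a linear subspace. -/
def IsLinearCode {p : ℕ} {ι : Type} (C : Set (ι → ZMod p)) : Prop :=
  ∃ V : Submodule (ZMod p) (ι → ZMod p), (V : Set (ι → ZMod p)) = C

/-! The binary Gray map is additive for bitwise exclusive or (`gray_two_xor`), and adding `2 ^ (r -
1)` to its argument complements the image (`gray_two_add_two_pow`).

If only step `s` is used, every row except row 1 has entries `0` and `2 ^ (r - 1)`, and row 1 has
entries `0` and `1` (`IsFlat`). Codewords are then `n • e + w`, with `e` row 1 and `w` contributing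
only complementations, so the sum of the images of `m • e + v` and `n • e + w` is the image of `(m
^^^ n) • e + (v + w)`.

If some step `i < s` is used, it adds a row `n` for which there are a column `a` over `ℤ_2` and
columns `b`, `c`, `d` over `ℤ_4` such that every codeword satisfies `2a = c - b - d`. For a codeword
whose image is the sum of the images of rows 1 and `n`, the Gray map forces `a = 0`, `b = 1`, `c =
0`, `d = 1`, and the relation would read `0 = -2` in `ℤ_4`. -/

/-! ### The binary Gray map -/

theorem digit_two_eq_testBit (n i : ℕ) : digit 2 n i = if n.testBit i then 1 else 0 := by
  rw [digit, ← Nat.toNat_testBit]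
  cases n.testBit i <;> simp

theorem digit_two_mod_two_pow {r i : ℕ} (h : i < r) (n : ℕ) :
    digit 2 (n % 2 ^ r) i = digit 2 n i := by
  simp [digit_two_eq_testBit, h]

theorem digit_two_xor (m n i : ℕ) : digit 2 (m ^^^ n) i = digit 2 m i + digit 2 n i := by
  simp only [digit_two_eq_testBit, Nat.testBit_xor]
  cases m.testBit i <;> cases n.testBit i <;> decide

/-- Only digits below `r` enter, so `n` need not be reduced modulo `2 ^ r`; this makes exclusive or
of arbitrary representatives usable. -/
theorem gray_two_natCast {r : ℕ} (hr : 1 ≤ r) (n : ℕ) (y : Fin (2 ^ (r - 1))) :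
    gray 2 r (n : ZMod (2 ^ r)) y =
      digit 2 n (r - 1) + ∑ i ∈ Finset.range (r - 1), digit 2 n i * digit 2 y i := by
  unfold gray
  rw [ZMod.val_natCast, digit_two_mod_two_pow (by omega)]
  congr 1
  refine Finset.sum_congr rfl fun i hi => ?_
  rw [digit_two_mod_two_pow (by have := Finset.mem_range.1 hi; omega)]

theorem gray_two_zero {r : ℕ} (hr : 1 ≤ r) (y : Fin (2 ^ (r - 1))) : gray 2 r 0 y = 0 := by
  simpa [digit] using gray_two_natCast hr 0 y

/-- The binary Gray map turns bitwise exclusive or into addition. -/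
theorem gray_two_xor {r : ℕ} (hr : 1 ≤ r) (m n : ℕ) (y : Fin (2 ^ (r - 1))) :
    gray 2 r ((m ^^^ n : ℕ) : ZMod (2 ^ r)) y =
      gray 2 r (m : ZMod (2 ^ r)) y + gray 2 r (n : ZMod (2 ^ r)) y := by
  simp only [gray_two_natCast hr, digit_two_xor, add_mul, Finset.sum_add_distrib]
  ring

/-- Adding `2 ^ (r - 1)` complements the binary Gray image. -/
theorem gray_two_add_two_pow {r : ℕ} (hr : 1 ≤ r) (u : ZMod (2 ^ r)) (y : Fin (2 ^ (r - 1))) :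
    gray 2 r (u + 2 ^ (r - 1)) y = gray 2 r u y + 1 := by
  obtain ⟨n, rfl⟩ := ZMod.natCast_zmod_surjective u
  have h : (n : ZMod (2 ^ r)) + 2 ^ (r - 1) = ((2 ^ (r - 1) + n : ℕ) : ZMod (2 ^ r)) := by
    push_cast; ring
  have htop : digit 2 (2 ^ (r - 1) + n) (r - 1) = digit 2 n (r - 1) + 1 := by
    simp only [digit_two_eq_testBit, Nat.testBit_two_pow_add_eq]
    cases n.testBit (r - 1) <;> decide
  have hlow : ∀ i ∈ Finset.range (r - 1), digit 2 (2 ^ (r - 1) + n) i = digit 2 n i := by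
    intro i hi
    simp only [digit_two_eq_testBit, Nat.testBit_two_pow_add_gt (Finset.mem_range.1 hi)]
  rw [h, gray_two_natCast hr, gray_two_natCast hr, htop,
    Finset.sum_congr rfl fun i hi => by rw [hlow i hi]]
  ring

theorem two_pow_pred_add_self {r : ℕ} (hr : 1 ≤ r) :
    (2 : ZMod (2 ^ r)) ^ (r - 1) + 2 ^ (r - 1) = 0 := by
  obtain ⟨r, rfl⟩ : ∃ q, r = q + 1 := ⟨r - 1, by omega⟩
  have h : ((2 ^ (r + 1) : ℕ) : ZMod (2 ^ (r + 1))) = 0 := ZMod.natCast_self _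
  push_cast at h
  rw [Nat.add_sub_cancel, ← two_mul, ← pow_succ', h]

/-- A binary code containing `0` and closed under addition is linear. -/
theorem isLinearCode_of_add_mem {ι : Type} {C : Set (ι → ZMod 2)} (h0 : 0 ∈ C)
    (hadd : ∀ x ∈ C, ∀ y ∈ C, x + y ∈ C) : IsLinearCode C := by
  refine ⟨⟨⟨⟨C, fun hx hy => hadd _ hx _ hy⟩, h0⟩, fun a x hx => ?_⟩, rfl⟩
  have ha : a = 0 ∨ a = 1 := by revert a; decide
  rcases ha with rfl | rfl
  · simpa using h0
  · simpa using hx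

/-! ### Blocks of the matrices and induction along the construction -/

namespace GenMatrix

theorem mem_appendRow {R : Type} {m : ℕ} {B : List (Fin m → R)} {xs : List R}
    {c : Fin (m + 1) → R} :
    c ∈ appendRow B xs ↔ ∃ x ∈ xs, ∃ b ∈ B, Fin.snoc (α := fun _ => R) b x = c := by
  simp [appendRow]

section Blocks

variable {p s i r : ℕ} {A : GenMatrix p}

theorem block_base_one : (base 2 s).block 1 = [![1, 0], ![1, 1]] :=
  rfl

theorem block_base_of_two_le (h : 2 ≤ r ∧ r ≤ s) :
    (base 2 s).block r = [![2 ^ (r - 1), 1]] := by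
  refine (if_neg (by omega)).trans ((if_pos h).trans ?_)
  simp only [List.pure_def, List.bind_eq_flatMap, Nat.add_one_sub_one, List.range'_one,
    List.flatMap_cons, List.flatMap_nil, List.append_nil, Nat.cast_one, List.map_cons, List.map_nil,
    Nat.cast_ofNat]
  rfl

theorem block_step_one : (step p s i A).block 1 =
    appendRow (A.block 1) ((List.range p).map fun a => (a : ZMod (p ^ 1))) :=
  rfl

theorem block_step_of_le (h : 2 ≤ r ∧ r ≤ s - i + 1) : (step p s i A).block r =
    appendRow (blockM p r A.rows) ((List.range' 1 (p - 1)).map fun a => (a : ZMod (p ^ r))) ++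
      appendRow (A.block r) ((List.range (p ^ r)).map fun a => (a : ZMod (p ^ r))) :=
  (if_neg (by omega)).trans (if_pos h)

theorem block_step_of_lt (h : s - i + 1 < r ∧ r ≤ s) : (step p s i A).block r =
    appendRow (A.block r) ((List.range (p ^ (s - i + 1))).map fun c =>
      (p : ZMod (p ^ r)) ^ (r - (s - i + 1)) * (c : ZMod (p ^ r))) :=
  (if_neg (by omega)).trans ((if_neg (by omega)).trans (if_pos h))

end Blocks

theorem step_iterate {p s i : ℕ} {P : GenMatrix p → Prop} (h : ∀ A, P A → P (step p s i A))
    (n : ℕ) (A : GenMatrix p) (hA : P A) : P ((step p s i)^[n] A) :=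
  Nat.rec hA (fun n ih => by rw [Function.iterate_succ_apply']; exact h _ ih) n

/-- A property that is preserved by every step that is actually used is preserved along the
construction of `A_p^{t₁,…,t_s}`. -/
theorem foldl_step {p s : ℕ} {t : ℕ → ℕ} {P : GenMatrix p → Prop} (l : List ℕ)
    (hstep : ∀ i ∈ l, numSteps s t i ≠ 0 → ∀ A, P A → P (step p s i A))
    (A : GenMatrix p) (hA : P A) :
    P (l.foldl (fun A i => (step p s i)^[numSteps s t i] A) A) := by
  induction l generalizing A with
  | nil => exact hA
  | cons i l ih =>
    refine ih (fun j hj => hstep j (List.mem_cons_of_mem _ hj)) _ ?_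
    by_cases h : numSteps s t i = 0
    · simpa [h] using hA
    · exact step_iterate (hstep i List.mem_cons_self h) _ _ hA

/-! ### Linear codes -/

/-- The row with index `1` has entries `0` and `1`, and in block `r` all other rows have entries
`0` and `2 ^ (r - 1)`. -/
def IsFlat (s : ℕ) (A : GenMatrix 2) : Prop :=
  1 < A.rows ∧ ∀ r, 1 ≤ r → r ≤ s → ∀ c ∈ A.block r, ∀ k : Fin A.rows,
    (k.val = 1 → c k = 0 ∨ c k = 1) ∧ (k.val ≠ 1 → c k = 0 ∨ c k = 2 ^ (r - 1))

theorem isFlat_base (s : ℕ) : IsFlat s (base 2 s) := by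
  refine ⟨Nat.one_lt_two, fun r hr hrs c hc k => ?_⟩
  change Fin 2 at k
  change Fin 2 → _ at c
  rcases hr.eq_or_lt with rfl | hr
  · have hc' : c = ![1, 0] ∨ c = ![1, 1] := List.mem_pair.1 (block_base_one (s := s) ▸ hc)
    rcases hc' with rfl | rfl <;> fin_cases k <;> simp
  · have hc' : c = ![2 ^ (r - 1), 1] :=
      List.mem_singleton.1 (block_base_of_two_le ⟨hr, hrs⟩ ▸ hc)
    subst hc'
    fin_cases k <;> simp

theorem IsFlat.step {s : ℕ} {A : GenMatrix 2} (hA : IsFlat s A) :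
    IsFlat s (step 2 s s A) := by
  refine ⟨Nat.lt_succ_of_lt hA.1, fun r hr hrs c hc k => ?_⟩
  change Fin (A.rows + 1) at k
  change Fin (A.rows + 1) → _ at c
  -- For `i = s` the threshold `s - i + 1` is 1, so each block `r ≥ 2` gets bottom entries `2 ^ (r -
  -- 1) * c` with `c < 2`; in block 1, `2 ^ (r - 1)` is 1.
  have hc' : ∃ x : ZMod (2 ^ r), (x = 0 ∨ x = 2 ^ (r - 1)) ∧
      ∃ b ∈ A.block r, Fin.snoc (α := fun _ => ZMod (2 ^ r)) b x = c := by
    rcases hr.eq_or_lt with rfl | hr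
    · obtain ⟨x, hx, h⟩ := mem_appendRow.1 (block_step_one (p := 2) ▸ hc)
      refine ⟨x, ?_, h⟩
      simpa [List.range_succ] using hx
    · obtain ⟨x, hx, h⟩ := mem_appendRow.1
        (block_step_of_lt (p := 2) (i := s) ⟨by omega, hrs⟩ ▸ hc)
      refine ⟨x, ?_, h⟩
      simpa [List.range_succ, eq_comm] using hx
  obtain ⟨x, hx, b, hb, rfl⟩ := hc'
  induction k using Fin.lastCases with
  | last =>
    have := hA.1
    refine ⟨fun h => ?_, fun _ => by simpa using hx⟩
    simp at h
    omega
  | cast k => simpa using hA.2 r hr hrs b hb k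

/-- The code generated by a flat matrix has a linear binary Gray image. -/
theorem IsFlat.isLinearCode {s : ℕ} {A : GenMatrix 2} (hA : IsFlat s A) :
    IsLinearCode (A.grayMap s '' (A.additiveCode s : Set (A.Word s))) := by
  set e : A.Word s := A.row s ⟨1, hA.1⟩ with he
  set D : AddSubgroup (A.Word s) :=
    AddSubgroup.closure (A.row s '' {k | k.val ≠ 1}) with hD
  have hDle : D ≤ A.additiveCode s := AddSubgroup.closure_mono (Set.image_subset_range _ _)
  have heC : e ∈ A.additiveCode s := AddSubgroup.subset_closure ⟨_, rfl⟩
  have he01 : ∀ r j, e r j = 0 ∨ e r j = 1 := fun r j =>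
    (hA.2 r (Finset.mem_Icc.1 r.2).1 (Finset.mem_Icc.1 r.2).2 _ (List.get_mem _ _) _).1 rfl
  have hDtop : ∀ w ∈ D, ∀ r j, w r j = 0 ∨ w r j = 2 ^ ((r : ℕ) - 1) := by
    intro w hw r j
    have hr := Finset.mem_Icc.1 r.2
    have htt := two_pow_pred_add_self hr.1
    induction hw using AddSubgroup.closure_induction with
    | mem w hw =>
      obtain ⟨k, hk, rfl⟩ := hw
      exact (hA.2 r hr.1 hr.2 _ (List.get_mem _ _) k).2 hk
    | zero => exact Or.inl rfl
    | add v w _ _ hv hw =>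
      rw [Pi.add_apply, Pi.add_apply]
      rcases hv with hv | hv <;> rcases hw with hw | hw <;> simp [hv, hw, htt]
    | neg w _ hw =>
      rw [Pi.neg_apply, Pi.neg_apply]
      rcases hw with hw | hw
      · simp [hw]
      · rw [hw]
        exact Or.inr (neg_eq_of_add_eq_zero_left htt)
  have hdecomp : ∀ z ∈ A.additiveCode s, ∃ n : ℕ, ∃ w ∈ D, z = n • e + w := by
    have hle : A.additiveCode s ≤ AddSubgroup.zmultiples e ⊔ D := by
      refine (AddSubgroup.closure_le _).2 ?_
      rintro _ ⟨k, rfl⟩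
      by_cases hk : k.val = 1
      · have : k = ⟨1, hA.1⟩ := Fin.ext hk
        subst this
        exact AddSubgroup.mem_sup_left (AddSubgroup.mem_zmultiples e)
      · exact AddSubgroup.mem_sup_right (AddSubgroup.subset_closure ⟨k, hk, rfl⟩)
    intro z hz
    -- The group is finite, so integer multiples of `e` are natural multiples, to which exclusive or
    -- applies.
    obtain ⟨y, hy, w, hw, rfl⟩ := AddSubgroup.mem_sup.1 (hle hz)
    obtain ⟨n, rfl⟩ := mem_multiples_iff_mem_zmultiples.2 hy
    exact ⟨n, w, hw, rfl⟩
  refine isLinearCode_of_add_mem ⟨0, zero_mem _, ?_⟩ ?_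
  · funext q
    exact gray_two_zero (Finset.mem_Icc.1 q.1.2).1 _
  rintro _ ⟨x, hx, rfl⟩ _ ⟨y, hy, rfl⟩
  obtain ⟨m, v, hv, rfl⟩ := hdecomp x hx
  obtain ⟨n, w, hw, rfl⟩ := hdecomp y hy
  refine ⟨(m ^^^ n) • e + (v + w),
    add_mem (nsmul_mem heC _) (add_mem (hDle hv) (hDle hw)), ?_⟩
  funext ⟨r, j, y⟩
  have hr := (Finset.mem_Icc.1 r.2).1
  have htt := two_pow_pred_add_self hr
  have h11 : (1 : ZMod 2) + 1 = 0 := rfl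
  have hmain : gray 2 r ((m ^^^ n) • e r j) y = gray 2 r (m • e r j) y + gray 2 r (n • e r j) y := by
    rcases he01 r j with h | h
    · simp [h, gray_two_zero hr]
    · simpa [h] using gray_two_xor hr m n y
  change gray 2 r ((m ^^^ n) • e r j + (v r j + w r j)) y =
    gray 2 r (m • e r j + v r j) y + gray 2 r (n • e r j + w r j) y
  -- Each top entry flips the image once; two of them cancel on both sides.
  rcases hDtop v hv r j with h | h <;> rcases hDtop w hw r j with h' | h' <;> rw [h, h']
  · simpa using hmain
  · rw [zero_add, add_zero, gray_two_add_two_pow hr, gray_two_add_two_pow hr, hmain]; ring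
  · rw [add_zero, add_zero, gray_two_add_two_pow hr, gray_two_add_two_pow hr, hmain]; ring
  · rw [htt, add_zero, gray_two_add_two_pow hr, gray_two_add_two_pow hr, hmain]
    linear_combination -h11

/-! ### Nonlinear codes -/

/-- Some column of block `r` has the entries `f 0, f 1, …`. -/
def HasCol {p : ℕ} (A : GenMatrix p) (r : ℕ) (f : ℕ → ZMod (p ^ r)) : Prop :=
  ∃ c ∈ A.block r, ∀ k : Fin A.rows, c k = f k

theorem exists_mem_appendRow {R : Type} {m : ℕ} {B : List (Fin m → R)} {xs : List R}
    {f : ℕ → R} (hB : ∃ c ∈ B, ∀ k : Fin m, c k = f k) (hx : f m ∈ xs) :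
    ∃ c ∈ appendRow B xs, ∀ k : Fin (m + 1), c k = f k := by
  obtain ⟨c, hc, h⟩ := hB
  refine ⟨_, mem_appendRow.2 ⟨f m, hx, c, hc, rfl⟩, fun k => ?_⟩
  induction k using Fin.lastCases with
  | last => simp
  | cast k => simpa using h k

theorem exists_mem_tuples {R : Type} {x : R} {l : List R} {f : ℕ → R} (hx : f 0 = x) {m : ℕ}
    (hl : ∀ k < m, f (k + 1) ∈ l) : ∃ c ∈ tuples x l (m + 1), ∀ k : Fin (m + 1), c k = f k := by
  induction m with
  | zero => exact ⟨_, List.mem_singleton_self _, fun k => by simp [hx]⟩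
  | succ m ih =>
    obtain ⟨c, hc, h⟩ := ih fun k hk => hl k (by omega)
    refine ⟨Fin.snoc (α := fun _ => R) c (f (m + 1)), ?_, fun k => ?_⟩
    · exact List.mem_flatMap.2 ⟨c, hc, List.mem_map.2 ⟨_, hl m (by omega), rfl⟩⟩
    · induction k using Fin.lastCases with
      | last => simp
      | cast k => simpa using h k

theorem HasCol.step_one {s i : ℕ} {A : GenMatrix 2} {f : ℕ → ZMod (2 ^ 1)}
    (h : A.HasCol 1 f) (h0 : f A.rows = 0) : (step 2 s i A).HasCol 1 f := by
  rw [HasCol, block_step_one]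
  exact exists_mem_appendRow h (by simp [h0, List.range_succ])

/-- Here all residues occur below the copies of the old block, so the new entry is unrestricted. -/
theorem HasCol.step_of_le {s i r : ℕ} (hr : 2 ≤ r ∧ r ≤ s - i + 1) {A : GenMatrix 2}
    {f : ℕ → ZMod (2 ^ r)} (h : A.HasCol r f) : (step 2 s i A).HasCol r f := by
  obtain ⟨c, hc, hf⟩ := exists_mem_appendRow
    (xs := (List.range (2 ^ r)).map fun a => (a : ZMod (2 ^ r))) h (by
      simp only [List.map_id_fun', id, List.pure_def, List.bind_eq_flatMap, List.mem_flatMap,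
        List.mem_singleton, List.mem_range]
      exact ⟨_, ZMod.val_lt _, (ZMod.natCast_zmod_val _).symm⟩)
  refine ⟨c, ?_, hf⟩
  rw [block_step_of_le hr]
  exact List.mem_append_right _ hc

/-- The bottom entry `0` is available in every step, whatever `i` is. -/
theorem HasCol.step {s i r : ℕ} (hr : 2 ≤ r) (hrs : r ≤ s) {A : GenMatrix 2}
    {f : ℕ → ZMod (2 ^ r)} (h : A.HasCol r f) (h0 : f A.rows = 0) :
    (step 2 s i A).HasCol r f := by
  by_cases hi : r ≤ s - i + 1
  · exact h.step_of_le ⟨hr, hi⟩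
  · rw [HasCol, block_step_of_lt ⟨by omega, hrs⟩]
    refine exists_mem_appendRow h ?_
    rw [h0]
    simp only [List.mem_map, List.pure_def, List.bind_eq_flatMap, List.mem_flatMap,
        List.mem_singleton, List.mem_range]
    exact ⟨0, ⟨0, by positivity, by simp⟩, by simp⟩

/-- Supplies the column `d`: the column `(2, 0, …, 0)` of the block `M_1`, above the new entry `1`.
The bound on `i` says `i < s`. -/
theorem hasCol_two_step_blockM {s i : ℕ} (hi : 2 ≤ s - i + 1) {A : GenMatrix 2}
    (hA : 0 < A.rows) :
    (step 2 s i A).HasCol 2 fun k => if k = 0 then 2 else if k = A.rows then 1 else 0 := by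
  set f : ℕ → ZMod (2 ^ 2) := fun k => if k = 0 then 2 else if k = A.rows then 1 else 0 with hf
  obtain ⟨m, hm⟩ : ∃ m, A.rows = m + 1 := ⟨A.rows - 1, by omega⟩
  have hM : ∃ c ∈ blockM 2 2 A.rows, ∀ k : Fin A.rows, c k = f k := by
    have hl : ∀ k < m, f (k + 1) ∈
        (List.range (2 ^ (2 - 1))).map fun a => ((2 : ℕ) : ZMod (2 ^ 2)) * (a : ZMod (2 ^ 2)) := by
      intro k hk
      have : f (k + 1) = 0 := by simp [hf, show k + 1 ≠ A.rows by omega]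
      simp [this, List.range_succ]
    have := exists_mem_tuples (f := f) (x := ((2 : ℕ) : ZMod (2 ^ 2)) ^ (2 - 1)) (by simp [hf]) hl
    rw [hm]
    exact this
  obtain ⟨c, hc, h⟩ := exists_mem_appendRow
    (xs := (List.range' 1 (2 - 1)).map fun a => (a : ZMod (2 ^ 2))) hM (by simp [hf, hA.ne'])
  refine ⟨c, ?_, h⟩
  rw [block_step_of_le ⟨le_rfl, hi⟩]
  exact List.mem_append_left _ hc

/-- The columns that are present throughout the construction. -/
def HasBaseCols (A : GenMatrix 2) : Prop :=
  2 ≤ A.rows ∧ (A.HasCol 1 fun k => if k = 0 then 1 else 0) ∧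
    A.HasCol 2 fun k => if k = 0 then 2 else if k = 1 then 1 else 0

/-- The columns that witness that row `n` makes the code nonlinear. -/
def HasWitnessCols (A : GenMatrix 2) (n : ℕ) : Prop :=
  2 ≤ n ∧ n < A.rows ∧ (A.HasCol 1 fun k => if k = 0 then 1 else 0) ∧
    (A.HasCol 2 fun k => if k = 0 then 2 else if k = 1 then 1 else 0) ∧
    (A.HasCol 2 fun k => if k = 0 then 2 else if k = 1 then 1 else if k = n then 1 else 0) ∧
    A.HasCol 2 fun k => if k = 0 then 2 else if k = n then 1 else 0

theorem hasBaseCols_base {s : ℕ} (hs : 2 ≤ s) : (base 2 s).HasBaseCols := by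
  refine ⟨le_rfl, ⟨![1, 0], ?_, fun k => ?_⟩, ⟨![2, 1], ?_, fun k => ?_⟩⟩
  · rw [block_base_one]
    exact List.mem_cons_self
  · change Fin 2 at k
    fin_cases k <;> simp
  · rw [block_base_of_two_le ⟨le_rfl, hs⟩]
    exact List.mem_cons_self
  · change Fin 2 at k
    fin_cases k <;> simp

theorem HasBaseCols.step {s : ℕ} (hs : 2 ≤ s) (i : ℕ) {A : GenMatrix 2} (hA : A.HasBaseCols) :
    (step 2 s i A).HasBaseCols := by
  obtain ⟨h, h1, h2⟩ := hA
  exact ⟨Nat.le_succ_of_le h, h1.step_one (if_neg (by omega)),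
    h2.step le_rfl hs (by rw [if_neg (by omega), if_neg (by omega)])⟩

/-- The new row has index `n = A.rows`. The old column `(2, 1, 0, …)` extended by `0` and by `1`
gives `b` and `c`; `d` comes from `M_1`. -/
theorem HasBaseCols.hasWitnessCols_step {s i : ℕ} (hs : 2 ≤ s) (hi : 2 ≤ s - i + 1)
    {A : GenMatrix 2} (hA : A.HasBaseCols) : (GenMatrix.step 2 s i A).HasWitnessCols A.rows := by
  have hB := hA.step hs i
  obtain ⟨h, -, h2⟩ := hA
  refine ⟨h, Nat.lt_succ_self _, hB.2.1, hB.2.2, ?_, hasCol_two_step_blockM hi (by omega)⟩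
  obtain ⟨c, hc, hf⟩ := h2
  exact HasCol.step_of_le ⟨le_rfl, hi⟩ ⟨c, hc, fun k => by simp [hf, k.2.ne]⟩

theorem HasWitnessCols.step {s : ℕ} (hs : 2 ≤ s) (i : ℕ) {A : GenMatrix 2} {n : ℕ}
    (hA : A.HasWitnessCols n) : (step 2 s i A).HasWitnessCols n := by
  obtain ⟨hn, hlt, h1, h2, h3, h4⟩ := hA
  refine ⟨hn, Nat.lt_succ_of_lt hlt, h1.step_one ?_, h2.step le_rfl hs ?_,
    h3.step le_rfl hs ?_, h4.step le_rfl hs ?_⟩ <;> grind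

theorem exists_hasWitnessCols_ofType {s : ℕ} (hs : 2 ≤ s) {t : ℕ → ℕ} {i : ℕ} (hi : 1 ≤ i)
    (his : i < s) (hti : numSteps s t i ≠ 0) : ∃ n, (ofType 2 s t).HasWitnessCols n := by
  obtain ⟨l₁, l₂, hl⟩ := List.append_of_mem
    (show i ∈ List.range' 1 s from List.mem_range'_1.2 ⟨hi, by omega⟩)
  rw [ofType, hl, List.foldl_append, List.foldl_cons]
  have h₁ := foldl_step (t := t) l₁ (fun j _ _ _ h => HasBaseCols.step hs j h) _
    (hasBaseCols_base hs)
  -- The first application of step `i` creates the witness columns; all later steps extend them by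
  -- zeros.
  obtain ⟨m, hm⟩ := Nat.exists_eq_succ_of_ne_zero hti
  set B := l₁.foldl (fun A i => (step 2 s i)^[numSteps s t i] A) (base 2 s)
  refine ⟨B.rows, foldl_step (P := fun A => A.HasWitnessCols B.rows) l₂
    (fun j _ _ _ h => h.step hs j) _ ?_⟩
  rw [hm, Function.iterate_succ_apply]
  exact step_iterate (P := fun A => A.HasWitnessCols B.rows) (fun _ h => h.step hs i) _ _
    (h₁.hasWitnessCols_step hs (by omega))

theorem eq_zero_of_gray_two_one {z : ZMod (2 ^ 1)}
    (h : ∀ y, gray 2 1 z y = gray 2 1 0 y + gray 2 1 0 y) : z = 0 := by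
  revert z; decide

/-- The Gray map is injective on `ℤ_4`, so the image determines `z`. The middle case causes the
contradiction: two equal images sum to zero, although `1 + 1 = 2`. -/
theorem eq_of_gray_two_two : ∀ {z : ZMod (2 ^ 2)},
    ((∀ y, gray 2 2 z y = gray 2 2 1 y + gray 2 2 0 y) → z = 1) ∧
    ((∀ y, gray 2 2 z y = gray 2 2 1 y + gray 2 2 1 y) → z = 0) ∧
    ((∀ y, gray 2 2 z y = gray 2 2 0 y + gray 2 2 1 y) → z = 1) := by
  decide

/-- The embedding `u ↦ 2u` of `ℤ_2` into `ℤ_4`. -/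
def doubling : ZMod (2 ^ 1) →+ ZMod (2 ^ 2) :=
  AddMonoidHom.mk' (fun u => 2 * u.cast) (by decide)

theorem doubling_add_eq {x x' : ZMod (2 ^ 1)} {b b' c c' d d' : ZMod (2 ^ 2)}
    (h : doubling x = c - b - d) (h' : doubling x' = c' - b' - d') :
    doubling (x + x') = c + c' - (b + b') - (d + d') := by
  rw [map_add, h, h']
  abel

theorem doubling_neg_eq {x : ZMod (2 ^ 1)} {b c d : ZMod (2 ^ 2)}
    (h : doubling x = c - b - d) : doubling (-x) = -c - -b - -d := by
  rw [map_neg, h]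
  abel

theorem doubling_zero_eq : doubling 0 = 0 - 0 - 0 := by decide

theorem doubling_zero_ne : doubling 0 ≠ 0 - 1 - 1 := by decide

theorem HasCol.exists_coord {s : ℕ} {A : GenMatrix 2} {r : ℕ} {f : ℕ → ZMod (2 ^ r)}
    (h : A.HasCol r f) (hr : r ∈ Finset.Icc 1 s) :
    ∃ j, ∀ k : Fin A.rows, A.row s k ⟨r, hr⟩ j = f k := by
  obtain ⟨c, hc, hf⟩ := h
  obtain ⟨j, rfl⟩ := List.get_of_mem hc
  exact ⟨j, hf⟩

theorem HasWitnessCols.not_isLinearCode {s : ℕ} (hs : 2 ≤ s) {A : GenMatrix 2} {n : ℕ}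
    (hA : A.HasWitnessCols n) :
    ¬ IsLinearCode (A.grayMap s '' (A.additiveCode s : Set (A.Word s))) := by
  rintro ⟨V, hV⟩
  obtain ⟨hn, hlt, h1, h2, h3, h4⟩ := hA
  have m1 : 1 ∈ Finset.Icc 1 s := Finset.mem_Icc.2 ⟨le_rfl, by omega⟩
  have m2 : 2 ∈ Finset.Icc 1 s := Finset.mem_Icc.2 ⟨by omega, hs⟩
  obtain ⟨a, ha⟩ := h1.exists_coord m1
  obtain ⟨b, hb⟩ := h2.exists_coord m2
  obtain ⟨c, hc⟩ := h3.exists_coord m2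
  obtain ⟨d, hd⟩ := h4.exists_coord m2
  -- The relation is additive, so rows suffice: row 0 gives `2 = 2 - 2 - 2` in `ℤ_4`, row 1 gives `0
  -- = 1 - 1 - 0`, row `n` gives `0 = 1 - 0 - 1`, and other rows vanish.
  have hrel : ∀ z ∈ A.additiveCode s,
      doubling (z ⟨1, m1⟩ a) = z ⟨2, m2⟩ c - z ⟨2, m2⟩ b - z ⟨2, m2⟩ d := by
    intro z hz
    induction hz using AddSubgroup.closure_induction with
    | mem z hz =>
      obtain ⟨k, rfl⟩ := hz
      rw [ha, hb, hc, hd]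
      by_cases k0 : (k : ℕ) = 0
      · simp only [k0, if_true]
        rfl
      · by_cases k1 : (k : ℕ) = 1
        · simp only [k1, if_true, show (1 : ℕ) ≠ n by omega, if_false, one_ne_zero]
          rfl
        · by_cases kn : (k : ℕ) = n
          · simp only [kn, if_true, if_false, show n ≠ 0 by omega, show n ≠ 1 by omega]
            rfl
          · simp only [k0, k1, kn, if_false]
            rfl
    | zero => exact doubling_zero_eq
    | add u v _ _ hu hv => exact doubling_add_eq hu hv
    | neg u _ hu => exact doubling_neg_eq hu
  have hrow : ∀ k, A.grayMap s (A.row s k) ∈ V := fun k => by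
    rw [← SetLike.mem_coe, hV]
    exact ⟨_, AddSubgroup.subset_closure ⟨k, rfl⟩, rfl⟩
  have hadd := V.add_mem (hrow ⟨1, by omega⟩) (hrow ⟨n, hlt⟩)
  rw [← SetLike.mem_coe, hV] at hadd
  obtain ⟨z, hz, hzeq⟩ := hadd
  have hgray : ∀ (r : Finset.Icc 1 s) (j) (y), gray 2 r (z r j) y =
      gray 2 r (A.row s ⟨1, by omega⟩ r j) y + gray 2 r (A.row s ⟨n, hlt⟩ r j) y :=
    fun r j y => congrFun hzeq ⟨r, j, y⟩
  have n0 : n ≠ 0 := by omega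
  have n1 : n ≠ 1 := by omega
  have za : z ⟨1, m1⟩ a = 0 := eq_zero_of_gray_two_one fun y => by
    simpa [ha, n0] using hgray ⟨1, m1⟩ a y
  have zb : z ⟨2, m2⟩ b = 1 := eq_of_gray_two_two.1 fun y => by
    simpa [hb, n0, n1] using hgray ⟨2, m2⟩ b y
  have zc : z ⟨2, m2⟩ c = 0 := eq_of_gray_two_two.2.1 fun y => by
    simpa [hc, n0, n1] using hgray ⟨2, m2⟩ c y
  have zd : z ⟨2, m2⟩ d = 1 := eq_of_gray_two_two.2.2 fun y => by
    simpa [hd, n0, n1, n1.symm] using hgray ⟨2, m2⟩ d y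
  have := hrel z hz
  rw [za, zb, zc, zd] at this
  exact doubling_zero_ne this

end GenMatrix

/-- Among the codes `H_2^{t₁,…,t_s}` (`s ≥ 2`, `t₁ ≥ 1`, `t₂, …, t_{s-1} ≥ 0`, `t_s ≥ 1`), exactly
the codes `H_2^{1,0,…,0,t_s}` are linear over `ℤ_2`. -/
theorem theorem2 (s : ℕ) (hs : 2 ≤ s) (t : ℕ → ℕ) (ht_first : 1 ≤ t 1) (ht_last : 1 ≤ t s) :
    IsLinearCode (codeH 2 s t) ↔ (t 1 = 1 ∧ ∀ i : ℕ, 1 < i → i < s → t i = 0) := by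
  constructor
  · intro h
    have hzero : ∀ i, 1 ≤ i → i < s → GenMatrix.numSteps s t i = 0 := by
      intro i hi his
      by_contra hti
      obtain ⟨n, hn⟩ := GenMatrix.exists_hasWitnessCols_ofType hs hi his hti
      exact hn.not_isLinearCode hs h
    refine ⟨?_, fun i hi his => ?_⟩
    · have := hzero 1 le_rfl (by omega)
      simp only [GenMatrix.numSteps, true_or, if_true] at this
      omega
    · have := hzero i hi.le his
      rwa [GenMatrix.numSteps, if_neg (by omega)] at this
  · rintro ⟨h1, h⟩
    refine GenMatrix.IsFlat.isLinearCode (GenMatrix.foldl_step _ ?_ _ (GenMatrix.isFlat_base s))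
    intro i hi hti A hA
    obtain ⟨hi1, his⟩ := List.mem_range'_1.1 hi
    -- Every step other than `s` is applied zero times; for `i = 1` this is `t 1 - 1 = 0`.
    obtain rfl : i = s := by
      by_contra hne
      refine hti ?_
      rcases hi1.eq_or_lt with rfl | hlt
      · simp [GenMatrix.numSteps, h1]
      · rw [GenMatrix.numSteps, if_neg (by omega), h i hlt (by omega)]
    exact hA.step
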